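/- Let $(V,\mu)$ be an infinite, connected, locally finite weighted graph: $\mu_{xy}=\mu_{yx}\ge 0$, $x\sim y$ iff $\mu_{xy}>0$ (loops allowed), $\mu(x)=\sum_{y\sim x}\mu_{xy}$, $\mu(V)=\sum_{x\in V}\mu(x)\in(0,\infty]$. Let $\Delta u(x)=\frac1{\mu(x)}\sum_{y\sim x}\mu_{xy}(u(y)-u(x))$; a function $u:V\to\mathbb R$ is harmonic if $\Delta u=0$ and superharmonic if $-\Delta u\ge 0$. Let $P_n$ be the $n$-step transition function of the random walk with transition probability $P(x,y)=\mu_{xy}/\mu(x)$, and let $g(x,y)=\sum_{n\ge0}P_n(x,y)/\mu(y)\in[0,\infty]$ be the Green function and $Gf(x)=\sum_y g(x,y)f(y)\mu(y)$ for $f\ge0$. Let $1\le p<\infty$ and let $q\in(1,\infty]$ be its Hölder conjugate. For finite $K\subset V$ put $$C_p(K)=\sup\Big\{\Big(\sum_{x\in K} f(x)\mu(x)\Big)^p:\ f:V\to[0,\infty),\ f=0 \text{ off } K,\ \|Gf\|_{L^q(V,\mu)}\le 1\Big\},$$ and for $q<\infty$ put $g_q(x,y)=\sum_{z\in V}g(x,z)\,g(z,y)^{q-1}\mu(z)\in[0,\infty]$.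 Theorem. (1) The following are equivalent: (I) $(V,\mu)$ is $L^p$-parabolic, that is, $C_p(K)=0$ for every finite $K\subset V$. (II) $(V,\mu)$ has the $L^q$-Liouville property: every non-negative superharmonic $u\in L^q(V,\mu)$ is constant. (III) Every non-negative solution $u$ of the system $-\Delta u\ge0$, $\Delta(|\Delta u|^{p-2}\Delta u)\ge0$ is harmonic. Here, given the first inequality, the second is read as $-\Delta(|\Delta u|^{p-1})\ge0$; for $p=1$ it is void. (2) If $p>1$, they are also equivalent to each of: $g_q(x,y)=\infty$ for some $x,y\in V$; $g_q(x,y)=\infty$ for all $x,y\in V$. (3) If $p>1$ and $\mu(V)=\infty$, then all equivalences in (1) and (2) also hold with "is constant" in (II) replaced by "is identically zero". -/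

import Mathlib

open scoped NNReal ENNReal

noncomputable section

/-- A locally finite weighted graph on the vertex set `V`: a symmetric edge weight
`μ_{xy} ≥ 0`, where `x ∼ y` means `μ_{xy} > 0` and every vertex has finitely many neighbours.
Loops are allowed. -/
structure WeightedGraph (V : Type*) where
  weight : V → V → ℝ≥0
  weight_symm : ∀ x y, weight x y = weight y x
  locallyFinite : ∀ x, {y | 0 < weight x y}.Finite

namespace WeightedGraph

variable {V : Type*} (G : WeightedGraph V)

/-- The underlying graph is connected (loops are irrelevant for this). -/
def Connected : Prop :=
  (SimpleGraph.fromRel fun x y => 0 < G.weight x y).Connected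

/-- The finite set `{y | y ∼ x}`. -/
def nbrs (x : V) : Finset V := (G.locallyFinite x).toFinset

/-- The vertex weight `μ(x) = ∑_{y ∼ x} μ_{xy}`. -/
def vertexWeight (x : V) : ℝ≥0 := ∑ y ∈ G.nbrs x, G.weight x y

/-- The total weight `μ(V) = ∑_x μ(x)`. -/
def totalWeight : ℝ≥0∞ := ∑' x, (G.vertexWeight x : ℝ≥0∞)

/-- The Laplacian `Δu(x) = μ(x)⁻¹ ∑_{y ∼ x} μ_{xy} (u(y) - u(x))`. -/
def laplacian (u : V → ℝ) (x : V) : ℝ :=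
  1 / (G.vertexWeight x : ℝ) * ∑ y ∈ G.nbrs x, (G.weight x y : ℝ) * (u y - u x)

def IsHarmonic (u : V → ℝ) : Prop := ∀ x, G.laplacian u x = 0

def IsSuperharmonic (u : V → ℝ) : Prop := ∀ x, 0 ≤ -G.laplacian u x

/-- The transition probability `P(x,y) = μ_{xy} / μ(x)` of the random walk. -/
def transition (x y : V) : ℝ≥0 := G.weight x y / G.vertexWeight x

open Classical in
/-- The `n`-step transition function `P_n(x,y)` of the random walk. -/
def stepTransition : ℕ → V → V → ℝ≥0
  | 0, x, y => if x = y then 1 else 0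
  | n + 1, x, y => ∑ z ∈ G.nbrs x, G.transition x z * stepTransition n z y

/-- The heat kernel `p_n(x,y) = P_n(x,y) / μ(y)`. -/
def heatKernel (n : ℕ) (x y : V) : ℝ≥0 := G.stepTransition n x y / G.vertexWeight y

/-- The Green function `g(x,y) = ∑_n p_n(x,y) ∈ [0,∞]`. -/
def green (x y : V) : ℝ≥0∞ := ∑' n, (G.heatKernel n x y : ℝ≥0∞)

/-- The Green operator `Gf(x) = ∑_y g(x,y) f(y) μ(y) ∈ [0,∞]` on non-negative functions. -/
def greenOp (f : V → ℝ≥0) (x : V) : ℝ≥0∞ :=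
  ∑' y, G.green x y * (f y : ℝ≥0∞) * (G.vertexWeight y : ℝ≥0∞)

/-- The norm of a `[0,∞]`-valued function in `L^q(V, μ)`, `1 ≤ q ≤ ∞`. -/
def lqNorm (q : ℝ≥0∞) (F : V → ℝ≥0∞) : ℝ≥0∞ :=
  if q = ∞ then ⨆ x, F x
  else (∑' x, F x ^ q.toReal * (G.vertexWeight x : ℝ≥0∞)) ^ (1 / q.toReal)

/-- `u ∈ L^q_+(V)`: `u` is non-negative and `q`-integrable (bounded, if `q = ∞`). -/
def MemLqPlus (q : ℝ≥0∞) (u : V → ℝ) : Prop :=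
  (∀ x, 0 ≤ u x) ∧ G.lqNorm q (fun x => ENNReal.ofReal |u x|) < ∞

/-- The `L^p`-capacity `C_p(K) = sup {ν(K)^p : ν = fμ, f ∈ ℓ⁺(K), ‖Gf‖_{L^q(V)} ≤ 1}` of a
finite set `K`, where `q` is the Hölder conjugate of `p`. -/
def capacity (p : ℝ) (K : Finset V) : ℝ≥0∞ :=
  ⨆ f ∈ {f : V → ℝ≥0 | (∀ x, x ∉ K → f x = 0) ∧
      G.lqNorm (ENNReal.conjExponent (ENNReal.ofReal p)) (G.greenOp f) ≤ 1},
    (∑ x ∈ K, (f x : ℝ≥0∞) * (G.vertexWeight x : ℝ≥0∞)) ^ p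

def IsLpParabolic (p : ℝ) : Prop := ∀ K : Finset V, G.capacity p K = 0

/-- Every superharmonic function in `L^q_+(V)` is constant. -/
def LqLiouville (q : ℝ≥0∞) : Prop :=
  ∀ u : V → ℝ, G.IsSuperharmonic u → G.MemLqPlus q u → ∃ c : ℝ, ∀ x, u x = c

/-- Every superharmonic function in `L^q_+(V)` is zero. -/
def LqLiouvilleZero (q : ℝ≥0∞) : Prop :=
  ∀ u : V → ℝ, G.IsSuperharmonic u → G.MemLqPlus q u → ∀ x, u x = 0

/-- `u` solves `-Δu ≥ 0`, `Δ(|Δu|^{p-2} Δu) ≥ 0`, where the second inequality is read as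
`-Δ(|Δu|^{p-1}) ≥ 0`. For `p > 1` the two forms agree by `isSystemSolution_iff` below; for `p = 1`
one has `|Δu|^0 = 1` and the second inequality is void. -/
def IsSystemSolution (p : ℝ) (u : V → ℝ) : Prop :=
  (∀ x, 0 ≤ -G.laplacian u x) ∧
    ∀ x, 0 ≤ -G.laplacian (fun y => |G.laplacian u y| ^ (p - 1)) x

theorem abs_rpow_mul_eq_neg {p t : ℝ} (hp : 1 < p) (ht : t ≤ 0) :
    |t| ^ (p - 2) * t = -(|t| ^ (p - 1)) := by
  rcases ht.eq_or_lt with rfl | h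
  · simp [Real.zero_rpow (show p - 1 ≠ 0 by linarith)]
  · have h1 : 0 < |t| := abs_pos.2 h.ne
    have h2 : p - 1 = (p - 2) + 1 := by ring
    rw [h2, Real.rpow_add h1, Real.rpow_one, abs_of_neg h]
    ring

theorem isSystemSolution_iff {p : ℝ} (hp : 1 < p) (u : V → ℝ) :
    G.IsSystemSolution p u ↔
      (∀ x, 0 ≤ -G.laplacian u x) ∧
        ∀ x, 0 ≤ G.laplacian
          (fun y => |G.laplacian u y| ^ (p - 2) * G.laplacian u y) x := by
  refine and_congr_right fun h => forall_congr' fun x => ?_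
  have e : (fun y => |G.laplacian u y| ^ (p - 2) * G.laplacian u y) =
      fun y => -(|G.laplacian u y| ^ (p - 1)) :=
    funext fun y => abs_rpow_mul_eq_neg hp (by linarith [h y])
  have e2 : ∀ f : V → ℝ, G.laplacian (fun y => -f y) x = -G.laplacian f x := by
    intro f
    simp only [laplacian]
    rw [← mul_neg, ← Finset.sum_neg_distrib]
    congr 1
    exact Finset.sum_congr rfl fun y _ => by ring
  rw [e, e2]

/-- Every non-negative solution of the system is harmonic. -/
def SystemLiouville (p : ℝ) : Prop :=
  ∀ u : V → ℝ, (∀ x, 0 ≤ u x) → G.IsSystemSolution p u → G.IsHarmonic u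

/-- The `L^q`-Green function `g_q(x,y) = ∑_z g(x,z) g(z,y)^{q-1} μ(z)`, for real `q > 1`. -/
def lqGreen (q : ℝ) (x y : V) : ℝ≥0∞ :=
  ∑' z, G.green x z * G.green z y ^ (q - 1) * (G.vertexWeight z : ℝ≥0∞)

end WeightedGraph

end

namespace WeightedGraph

variable {V : Type*} (G : WeightedGraph V)

/-! Every condition is equivalent to the failure of `HasLqGreen q`, that is, to no Green function
g(·,y) lying in L^q.

The Green potential of f is the least F ≥ 0 with F ≥ f + PF (`potential_le`). Hence a non-negative
superharmonic u dominates G(-Δu), and so a positive multiple of some g(·,y) unless u is harmonic. If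
u is merely non-constant, a truncation min(u, u(z)) is superharmonic but not harmonic, and the bound
applies to it (`IsSuperharmonic.exists_green_le_min`). Conversely, a g(·,y) in L^q is finite,
superharmonic and not harmonic, so it refutes (II); a small point mass at y then shows positive
capacity.

For (III) with p > 1, put w = |Δu|^(p-1). As (p-1)(q-1) = 1, -Δu = w^(q-1). If w is not constant it
dominates c g(·,y), whence u(y) ≥ c^(q-1) g_q(y,y). In the other direction g_q(·,y), when finite,
solves the system. Finally g_q(y,y) is the q-th power of the L^q norm of g(·,y), and finiteness of
g_q spreads along edges in both variables. -/

theorem mem_nbrs {x y : V} : y ∈ G.nbrs x ↔ 0 < G.weight x y := by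
  simp [nbrs]

variable {G}

theorem Connected.induction (hG : G.Connected) {Q : V → Prop}
    (h : ∀ x y, 0 < G.weight x y → Q x → Q y) {x : V} (hx : Q x) (y : V) : Q y := by
  obtain ⟨w⟩ := hG.preconnected x y
  induction w with
  | nil => exact hx
  | cons hadj _ ih =>
    refine ih (h _ _ ?_ hx)
    rw [SimpleGraph.fromRel_adj] at hadj
    rcases hadj.2 with h' | h'
    · exact h'
    · rwa [G.weight_symm]

theorem Connected.vertexWeight_pos [Infinite V] (hG : G.Connected) (x : V) :
    0 < G.vertexWeight x := by
  obtain ⟨y, hy⟩ := hG.preconnected.exists_adj_of_nontrivial x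
  rw [SimpleGraph.fromRel_adj] at hy
  have hw : 0 < G.weight x y := by
    rcases hy.2 with h | h
    · exact h
    · rwa [G.weight_symm]
  exact hw.trans_le
    (Finset.single_le_sum (f := G.weight x) (fun _ _ => zero_le) (G.mem_nbrs.2 hw))

/-! ### Random walk and symmetry of the Green function. -/

variable (G)

theorem sum_transition {x : V} (hx : 0 < G.vertexWeight x) :
    ∑ y ∈ G.nbrs x, G.transition x y = 1 := by
  simp only [transition]
  rw [← Finset.sum_div]
  exact div_self hx.ne'

theorem transition_pos {x y : V} (hx : 0 < G.vertexWeight x) (h : 0 < G.weight x y) :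
    0 < G.transition x y := div_pos h hx

theorem vertexWeight_mul_transition {x : V} (hx : 0 < G.vertexWeight x) (y : V) :
    G.vertexWeight x * G.transition x y = G.weight x y := by
  rw [transition, mul_div_cancel₀ _ hx.ne']

theorem mem_nbrs_comm {x y : V} : x ∈ G.nbrs y ↔ y ∈ G.nbrs x := by
  rw [mem_nbrs, mem_nbrs, G.weight_symm]

theorem stepTransition_succ (n : ℕ) (x y : V) : G.stepTransition (n + 1) x y =
    ∑ z ∈ G.nbrs x, G.transition x z * G.stepTransition n z y := rfl

/-- Splits off the last step of the walk, where the definition splits off the first; reversibility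
needs both. -/
theorem stepTransition_succ' (n : ℕ) (x y : V) : G.stepTransition (n + 1) x y =
    ∑ z ∈ G.nbrs y, G.stepTransition n x z * G.transition z y := by
  classical
  induction n generalizing x with
  | zero =>
    simp only [stepTransition, mul_ite, mul_one, mul_zero, ite_mul, one_mul, zero_mul,
      Finset.sum_ite_eq, Finset.sum_ite_eq', G.mem_nbrs_comm (x := x)]
  | succ n ih =>
    rw [stepTransition_succ]
    simp_rw [ih, Finset.mul_sum]
    rw [Finset.sum_comm]
    refine Finset.sum_congr rfl fun z _ => ?_
    rw [stepTransition_succ, Finset.sum_mul]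
    exact Finset.sum_congr rfl fun w _ => by ring

variable {G}

theorem vertexWeight_mul_stepTransition (hμ : ∀ x, 0 < G.vertexWeight x) (n : ℕ) (x y : V) :
    G.vertexWeight x * G.stepTransition n x y = G.vertexWeight y * G.stepTransition n y x := by
  induction n generalizing x with
  | zero =>
    by_cases h : x = y
    · subst h; rfl
    · simp [stepTransition, h, Ne.symm h]
  | succ n ih =>
    rw [stepTransition_succ, stepTransition_succ', Finset.mul_sum, Finset.mul_sum]
    refine Finset.sum_congr rfl fun z _ => ?_
    rw [← mul_assoc, vertexWeight_mul_transition G (hμ x), G.weight_symm,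
      ← vertexWeight_mul_transition G (hμ z), mul_right_comm, ih, mul_assoc]

theorem green_comm (hμ : ∀ x, 0 < G.vertexWeight x) (x y : V) : G.green x y = G.green y x := by
  refine tsum_congr fun n => ?_
  rw [heatKernel, heatKernel, ENNReal.coe_inj, div_eq_div_iff (hμ y).ne' (hμ x).ne',
    mul_comm, vertexWeight_mul_stepTransition hμ, mul_comm]

/-! ### Green potentials with values in [0,∞]. -/

variable (G)

/-- The averaging operator `PF(x) = ∑_{y ∼ x} P(x,y) F(y)` on `[0,∞]`-valued functions. -/
noncomputable def avg (F : V → ℝ≥0∞) (x : V) : ℝ≥0∞ :=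
  ∑ y ∈ G.nbrs x, (G.transition x y : ℝ≥0∞) * F y

/-- The Green potential of a `[0,∞]`-valued function. -/
noncomputable def potential (f : V → ℝ≥0∞) (x : V) : ℝ≥0∞ :=
  ∑' y, G.green x y * f y * (G.vertexWeight y : ℝ≥0∞)

variable {G}

theorem avg_mono {F F' : V → ℝ≥0∞} (h : ∀ x, F x ≤ F' x) (x : V) : G.avg F x ≤ G.avg F' x :=
  Finset.sum_le_sum fun y _ => by gcongr; exact h y

theorem tsum_stepTransition_zero (f : V → ℝ≥0∞) (x : V) :
    ∑' y, (G.stepTransition 0 x y : ℝ≥0∞) * f y = f x := by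
  rw [tsum_eq_single x]
  · simp [stepTransition]
  · intro y hy
    simp [stepTransition, hy.symm]

theorem tsum_stepTransition_succ (n : ℕ) (f : V → ℝ≥0∞) (x : V) :
    ∑' y, (G.stepTransition (n + 1) x y : ℝ≥0∞) * f y =
      G.avg (fun z => ∑' y, (G.stepTransition n z y : ℝ≥0∞) * f y) x := by
  simp only [stepTransition_succ, avg, ← ENNReal.tsum_mul_left]
  rw [← Summable.tsum_finsetSum fun _ _ => ENNReal.summable]
  refine tsum_congr fun y => ?_
  push_cast
  rw [Finset.sum_mul]
  exact Finset.sum_congr rfl fun z _ => by ring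

theorem potential_eq_tsum (hμ : ∀ x, 0 < G.vertexWeight x) (f : V → ℝ≥0∞) (x : V) :
    G.potential f x = ∑' n, ∑' y, (G.stepTransition n x y : ℝ≥0∞) * f y := by
  rw [ENNReal.tsum_comm]
  refine tsum_congr fun y => ?_
  rw [green, mul_assoc, ← ENNReal.tsum_mul_right]
  refine tsum_congr fun n => ?_
  rw [heatKernel, ENNReal.coe_div (hμ y).ne', mul_comm (f y), ← mul_assoc,
    ENNReal.div_mul_cancel (by simpa using (hμ y).ne') ENNReal.coe_ne_top]

theorem potential_eq_add_avg (hμ : ∀ x, 0 < G.vertexWeight x) (f : V → ℝ≥0∞) (x : V) :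
    G.potential f x = f x + G.avg (G.potential f) x := by
  rw [potential_eq_tsum hμ, tsum_eq_zero_add' ENNReal.summable, tsum_stepTransition_zero]
  simp_rw [tsum_stepTransition_succ]
  congr 1
  simp only [avg]
  rw [Summable.tsum_finsetSum fun _ _ => ENNReal.summable]
  refine Finset.sum_congr rfl fun y _ => ?_
  rw [ENNReal.tsum_mul_left, potential_eq_tsum hμ]

/-- Minimality of the potential: iterating f + PF ≤ F keeps each partial sum of the Neumann series ∑
Pⁿf below F. -/
theorem potential_le (hμ : ∀ x, 0 < G.vertexWeight x) {f F : V → ℝ≥0∞}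
    (h : ∀ x, f x + G.avg F x ≤ F x) (x : V) : G.potential f x ≤ F x := by
  rw [potential_eq_tsum hμ, ENNReal.tsum_eq_iSup_nat]
  refine iSup_le fun N => ?_
  induction N generalizing x with
  | zero => simp
  | succ N ih =>
    rw [Finset.sum_range_succ', tsum_stepTransition_zero, add_comm]
    refine le_trans ?_ (h x)
    gcongr
    refine le_trans (le_of_eq ?_) (avg_mono ih x)
    simp_rw [tsum_stepTransition_succ, avg]
    rw [Finset.sum_comm]
    simp_rw [Finset.mul_sum]

theorem mul_le_potential (f : V → ℝ≥0∞) (x y : V) :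
    G.green x y * (f y * G.vertexWeight y) ≤ G.potential f x := by
  rw [← mul_assoc]
  exact ENNReal.le_tsum (f := fun y => G.green x y * f y * (G.vertexWeight y : ℝ≥0∞)) y

open Classical in
theorem potential_single (y : V) (c : ℝ≥0∞) (x : V) :
    G.potential (Pi.single y c) x = G.green x y * (c * G.vertexWeight y) := by
  rw [potential, tsum_eq_single y]
  · simp [mul_assoc]
  · intro z hz
    simp [hz]

open Classical in
theorem green_eq_potential (hμ : ∀ x, 0 < G.vertexWeight x) (y : V) :
    (fun x => G.green x y) = G.potential (Pi.single y (G.vertexWeight y : ℝ≥0∞)⁻¹) := by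
  funext x
  rw [potential_single, ENNReal.inv_mul_cancel (by simpa using (hμ y).ne') ENNReal.coe_ne_top,
    mul_one]

open Classical in
theorem green_eq_add_avg (hμ : ∀ x, 0 < G.vertexWeight x) (x y : V) :
    G.green x y = (Pi.single y (G.vertexWeight y : ℝ≥0∞)⁻¹ : V → ℝ≥0∞) x
      + G.avg (fun z => G.green z y) x := by
  have h := green_eq_potential hμ y
  rw [h, ← potential_eq_add_avg hμ, ← h]

theorem green_self_pos (hμ : ∀ x, 0 < G.vertexWeight x) (y : V) : 0 < G.green y y := by
  classical
  rw [green_eq_add_avg hμ]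
  simp

/-! ### Comparison of Green functions at neighbouring vertices. -/

theorem transition_mul_le_avg (F : V → ℝ≥0∞) {x y : V} (h : 0 < G.weight x y) :
    (G.transition x y : ℝ≥0∞) * F y ≤ G.avg F x :=
  Finset.single_le_sum (f := fun y => (G.transition x y : ℝ≥0∞) * F y)
    (fun _ _ => zero_le) (G.mem_nbrs.2 h)

theorem transition_mul_green_le (hμ : ∀ x, 0 < G.vertexWeight x) {x y : V}
    (h : 0 < G.weight x y) (z : V) :
    (G.transition x y : ℝ≥0∞) * G.green y z ≤ G.green x z := by
  rw [green_eq_add_avg hμ x z]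
  exact (transition_mul_le_avg (fun w => G.green w z) h).trans le_add_self

theorem green_le (hμ : ∀ x, 0 < G.vertexWeight x) {x y : V}
    (h : 0 < G.weight x y) (z : V) :
    G.green y z ≤ (G.transition x y : ℝ≥0∞)⁻¹ * G.green x z := by
  have hp := G.transition_pos (hμ x) h
  rw [← ENNReal.mul_le_iff_le_inv (by simpa using hp.ne') ENNReal.coe_ne_top]
  exact transition_mul_green_le hμ h z

theorem lqGreen_ne_top_of_adj_left (hμ : ∀ x, 0 < G.vertexWeight x) {q : ℝ} {x x' : V}
    (h : 0 < G.weight x x') {y : V} (hf : G.lqGreen q x y ≠ ∞) : G.lqGreen q x' y ≠ ∞ := by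
  have hp := G.transition_pos (hμ x) h
  refine ne_top_of_le_ne_top
    (ENNReal.mul_ne_top (a := (G.transition x x' : ℝ≥0∞)⁻¹) (by simpa using hp.ne') hf) ?_
  rw [lqGreen, lqGreen, ← ENNReal.tsum_mul_left]
  refine ENNReal.tsum_le_tsum fun z => ?_
  rw [← mul_assoc, ← mul_assoc]
  gcongr
  exact green_le hμ h z

theorem lqGreen_ne_top_of_adj_right (hμ : ∀ x, 0 < G.vertexWeight x) {q : ℝ} (hq : 1 < q)
    {y y' : V} (h : 0 < G.weight y y') {x : V} (hf : G.lqGreen q x y ≠ ∞) :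
    G.lqGreen q x y' ≠ ∞ := by
  have hp := G.transition_pos (hμ y) h
  have hq' : 0 ≤ q - 1 := by linarith
  refine ne_top_of_le_ne_top
    (ENNReal.mul_ne_top (a := (G.transition y y' : ℝ≥0∞)⁻¹ ^ (q - 1))
      (ENNReal.rpow_ne_top_of_nonneg hq' (by simpa using hp.ne')) hf) ?_
  rw [lqGreen, lqGreen, ← ENNReal.tsum_mul_left]
  refine ENNReal.tsum_le_tsum fun z => ?_
  rw [← mul_assoc, mul_left_comm, ← ENNReal.mul_rpow_of_nonneg _ _ hq']
  gcongr
  rw [green_comm hμ z y', green_comm hμ z y]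
  exact green_le hμ h z

theorem Connected.lqGreen_ne_top [Infinite V] (hG : G.Connected) {q : ℝ} (hq : 1 < q)
    {x y : V} (h : G.lqGreen q x y ≠ ∞) (x' y' : V) : G.lqGreen q x' y' ≠ ∞ := by
  have hx : G.lqGreen q x' y ≠ ∞ := hG.induction (Q := fun x => G.lqGreen q x y ≠ ∞)
    (fun _ _ hadj => lqGreen_ne_top_of_adj_left hG.vertexWeight_pos hadj) h x'
  exact hG.induction (Q := fun y => G.lqGreen q x' y ≠ ∞)
    (fun _ _ hadj => lqGreen_ne_top_of_adj_right hG.vertexWeight_pos hq hadj) hx y'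

theorem lqGreen_self (hμ : ∀ x, 0 < G.vertexWeight x) {q : ℝ} (hq : 1 < q) (y : V) :
    G.lqGreen q y y = ∑' x, G.green x y ^ q * (G.vertexWeight x : ℝ≥0∞) := by
  refine tsum_congr fun x => ?_
  rw [green_comm hμ y x]
  congr 1
  have h := ENNReal.rpow_add_of_nonneg (x := G.green x y) 1 (q - 1) zero_le_one (by linarith)
  rw [ENNReal.rpow_one, add_sub_cancel] at h
  exact h.symm

/-! ### L^q norms. -/

theorem lqNorm_lt_top_iff {q : ℝ≥0∞} (hq : q ≠ ∞) (hq0 : 0 < q.toReal) (F : V → ℝ≥0∞) :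
    G.lqNorm q F < ∞ ↔ ∑' x, F x ^ q.toReal * (G.vertexWeight x : ℝ≥0∞) < ∞ := by
  rw [lqNorm, if_neg hq, ENNReal.rpow_lt_top_iff_of_pos (by positivity)]

theorem lqNorm_green_lt_top_iff (hμ : ∀ x, 0 < G.vertexWeight x) {q : ℝ≥0∞} (hq : q ≠ ∞)
    (hq1 : 1 < q.toReal) (y : V) :
    G.lqNorm q (fun x => G.green x y) < ∞ ↔ G.lqGreen q.toReal y y < ∞ := by
  rw [lqNorm_lt_top_iff hq (by linarith), lqGreen_self hμ hq1]

theorem lqNorm_mono {q : ℝ≥0∞} {F F' : V → ℝ≥0∞} (h : ∀ x, F x ≤ F' x) :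
    G.lqNorm q F ≤ G.lqNorm q F' := by
  unfold lqNorm
  split_ifs
  · exact iSup_mono h
  · gcongr with x
    exact h x

theorem lqNorm_mul_const {q : ℝ≥0∞} (hq : 1 ≤ q) (F : V → ℝ≥0∞) (c : ℝ≥0∞) :
    G.lqNorm q (fun x => F x * c) = G.lqNorm q F * c := by
  unfold lqNorm
  split_ifs with h
  · rw [ENNReal.iSup_mul]
  · have h0 : 0 < q.toReal := ENNReal.toReal_pos (zero_lt_one.trans_le hq).ne' h
    simp_rw [ENNReal.mul_rpow_of_nonneg _ _ h0.le, mul_right_comm _ (c ^ q.toReal)]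
    rw [ENNReal.tsum_mul_right, ENNReal.mul_rpow_of_nonneg _ _ (by positivity),
      ← ENNReal.rpow_mul, mul_one_div_cancel h0.ne', ENNReal.rpow_one]

theorem ne_top_of_lqNorm_lt_top (hμ : ∀ x, 0 < G.vertexWeight x) {q : ℝ≥0∞} (hq : 1 ≤ q)
    {F : V → ℝ≥0∞} (h : G.lqNorm q F < ∞) (x : V) : F x ≠ ∞ := by
  by_cases hq' : q = ∞
  · rw [lqNorm, if_pos hq'] at h
    exact ((le_iSup F x).trans_lt h).ne
  · have h0 : 0 < q.toReal := ENNReal.toReal_pos (zero_lt_one.trans_le hq).ne' hq'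
    rw [lqNorm_lt_top_iff hq' h0] at h
    intro hx
    have := ENNReal.ne_top_of_tsum_ne_top h.ne x
    rw [hx, ENNReal.top_rpow_of_pos h0, ENNReal.top_mul (by simpa using (hμ x).ne')] at this
    exact this rfl

/-! ### Superharmonic functions and truncation. -/

theorem laplacian_eq {x : V} (hx : 0 < G.vertexWeight x) (u : V → ℝ) :
    G.laplacian u x = ∑ y ∈ G.nbrs x, (G.transition x y : ℝ) * u y - u x := by
  have h1 : ∑ y ∈ G.nbrs x, (G.transition x y : ℝ) = 1 := by
    exact_mod_cast G.sum_transition hx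
  have h2 : u x = ∑ y ∈ G.nbrs x, (G.transition x y : ℝ) * u x := by
    rw [← Finset.sum_mul, h1, one_mul]
  conv_rhs => rw [h2]
  rw [laplacian, Finset.mul_sum, ← Finset.sum_sub_distrib]
  refine Finset.sum_congr rfl fun y _ => ?_
  rw [transition]
  push_cast
  ring

theorem laplacian_const (c : ℝ) (x : V) : G.laplacian (fun _ => c) x = 0 := by
  simp [laplacian]

theorem avg_ofReal {u : V → ℝ} (hu : ∀ x, 0 ≤ u x) (x : V) :
    G.avg (fun y => ENNReal.ofReal (u y)) x =
      ENNReal.ofReal (∑ y ∈ G.nbrs x, (G.transition x y : ℝ) * u y) := by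
  rw [ENNReal.ofReal_sum_of_nonneg fun y _ => mul_nonneg (by positivity) (hu y)]
  refine Finset.sum_congr rfl fun y _ => ?_
  rw [ENNReal.ofReal_mul (by positivity), ENNReal.ofReal_coe_nnreal]

theorem IsSuperharmonic.potential_le (hμ : ∀ x, 0 < G.vertexWeight x) {u : V → ℝ}
    (hu : ∀ x, 0 ≤ u x) (hs : G.IsSuperharmonic u) (x : V) :
    G.potential (fun y => ENNReal.ofReal (-G.laplacian u y)) x ≤ ENNReal.ofReal (u x) := by
  refine WeightedGraph.potential_le hμ (F := fun y => ENNReal.ofReal (u y)) (fun y => ?_) x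
  rw [avg_ofReal hu, ← ENNReal.ofReal_add (hs y)
    (Finset.sum_nonneg fun z _ => mul_nonneg (by positivity) (hu z)), laplacian_eq (hμ y)]
  exact ENNReal.ofReal_le_ofReal (by linarith)

theorem IsSuperharmonic.exists_green_le (hμ : ∀ x, 0 < G.vertexWeight x) {u : V → ℝ}
    (hu : ∀ x, 0 ≤ u x) (hs : G.IsSuperharmonic u) (hn : ¬ G.IsHarmonic u) :
    ∃ (y : V) (c : ℝ≥0∞), c ≠ 0 ∧ c ≠ ∞ ∧ ∀ x, G.green x y * c ≤ ENNReal.ofReal (u x) := by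
  obtain ⟨y, hy⟩ := not_forall.1 hn
  have hpos : 0 < -G.laplacian u y := (hs y).lt_of_ne' (by simpa using hy)
  refine ⟨y, ENNReal.ofReal (-G.laplacian u y) * G.vertexWeight y, ?_, ?_, fun x => ?_⟩
  · exact mul_ne_zero (by simpa using hpos) (by simpa using (hμ y).ne')
  · exact ENNReal.mul_ne_top ENNReal.ofReal_ne_top ENNReal.coe_ne_top
  · exact (mul_le_potential (fun y => ENNReal.ofReal (-G.laplacian u y)) x y).trans
      (hs.potential_le hμ hu x)

theorem IsSuperharmonic.min_const (hμ : ∀ x, 0 < G.vertexWeight x) {u : V → ℝ}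
    (hs : G.IsSuperharmonic u) (c : ℝ) : G.IsSuperharmonic fun x => min (u x) c := by
  intro x
  have hx := hs x
  have h1 : ∑ y ∈ G.nbrs x, (G.transition x y : ℝ) = 1 := by
    exact_mod_cast G.sum_transition (hμ x)
  rw [laplacian_eq (hμ x)] at hx ⊢
  have h2 : ∑ y ∈ G.nbrs x, (G.transition x y : ℝ) * min (u y) c ≤
      ∑ y ∈ G.nbrs x, (G.transition x y : ℝ) * u y :=
    Finset.sum_le_sum fun y _ => by gcongr; exact min_le_left _ _
  have h3 : ∑ y ∈ G.nbrs x, (G.transition x y : ℝ) * min (u y) c ≤ c := by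
    calc _ ≤ ∑ y ∈ G.nbrs x, (G.transition x y : ℝ) * c :=
          Finset.sum_le_sum fun y _ => by gcongr; exact min_le_right _ _
      _ = c := by rw [← Finset.sum_mul, h1, one_mul]
  rcases min_choice (u x) c with h | h <;> rw [h] <;> linarith

/-- Local minimum principle: at a minimum the terms of the Laplacian are non-negative, so if they
sum to zero each one vanishes. -/
theorem eq_of_harmonic_at_min (hμ : ∀ x, 0 < G.vertexWeight x) {u : V → ℝ} {x y : V}
    (hxy : 0 < G.weight x y) (h0 : G.laplacian u x = 0) (h : ∀ z ∈ G.nbrs x, u x ≤ u z) :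
    u y = u x := by
  have h0' : ∑ z ∈ G.nbrs x, (G.weight x z : ℝ) * (u z - u x) = 0 := by
    rw [laplacian] at h0
    refine (mul_eq_zero.1 h0).resolve_left ?_
    have := hμ x
    positivity
  rw [Finset.sum_eq_zero_iff_of_nonneg
    fun z hz => mul_nonneg (by positivity) (sub_nonneg.2 (h z hz))] at h0'
  have := h0' y (G.mem_nbrs.2 hxy)
  rcases mul_eq_zero.1 this with h' | h'
  · exact absurd h' (by exact_mod_cast hxy.ne')
  · linarith

theorem laplacian_neg (u : V → ℝ) (x : V) :
    G.laplacian (fun y => -u y) x = -G.laplacian u x := by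
  simp only [laplacian]
  rw [← mul_neg, ← Finset.sum_neg_distrib]
  congr 1
  exact Finset.sum_congr rfl fun y _ => by ring

theorem Connected.exists_adj_lt (hG : G.Connected) {u : V → ℝ}
    (hn : ¬ ∃ c : ℝ, ∀ x, u x = c) : ∃ x y, 0 < G.weight x y ∧ u x < u y := by
  by_contra! h
  obtain ⟨x⟩ := hG.nonempty
  refine hn ⟨u x, fun y => hG.induction (Q := fun y => u y = u x) (fun a b hab ha => ?_) rfl y⟩
  have h1 := h a b hab
  have h2 := h b a (by rwa [G.weight_symm])
  linarith

/-- Truncating a non-constant function at a suitable level destroys harmonicity. -/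
theorem Connected.exists_min_not_isHarmonic [Infinite V] (hG : G.Connected) {u : V → ℝ}
    (hn : ¬ ∃ c : ℝ, ∀ x, u x = c) :
    ∃ x, ¬ G.IsHarmonic fun y => min (u y) (u x) := by
  have hμ := hG.vertexWeight_pos
  obtain ⟨x, y, hxy, hlt⟩ := hG.exists_adj_lt hn
  by_contra! hh
  -- Truncated at level u x, the function has its maximum at x; harmonicity there forces the value u
  -- x at every neighbour.
  have key : ∀ z ∈ G.nbrs x, u x ≤ u z := by
    intro z hz
    have h1 : G.laplacian (fun w => -min (u w) (u x)) x = 0 := by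
      rw [laplacian_neg, hh x x, neg_zero]
    have h2 := eq_of_harmonic_at_min hμ (G.mem_nbrs.1 hz) h1 (fun w _ => by simp)
    simp only [min_self, neg_inj] at h2
    exact min_eq_right_iff.1 h2
  -- Thus x is a local minimum of u, hence also of the truncation at the higher level u y;
  -- harmonicity of the latter would give u y = u x.
  have hx : ∀ z ∈ G.nbrs x, min (u z) (u y) ≥ min (u x) (u y) :=
    fun z hz => min_le_min_right _ (key z hz)
  have h3 := eq_of_harmonic_at_min hμ hxy (hh y x) hx
  simp only [min_self, min_eq_left hlt.le] at h3
  linarith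

/-- A non-constant non-negative superharmonic function has a truncation that dominates a
multiple of the Green function. -/
theorem IsSuperharmonic.exists_green_le_min [Infinite V] (hG : G.Connected) {u : V → ℝ}
    (hu : ∀ x, 0 ≤ u x) (hs : G.IsSuperharmonic u) (hn : ¬ ∃ c : ℝ, ∀ x, u x = c) :
    ∃ (y z : V) (c : ℝ≥0∞), c ≠ 0 ∧ c ≠ ∞ ∧
      ∀ x, G.green x y * c ≤ ENNReal.ofReal (min (u x) (u z)) := by
  have hμ := hG.vertexWeight_pos
  obtain ⟨z, hz⟩ := hG.exists_min_not_isHarmonic hn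
  obtain ⟨y, c, h⟩ := (hs.min_const hμ (u z)).exists_green_le hμ (fun x => le_min (hu x) (hu z)) hz
  exact ⟨y, z, c, h⟩

/-! ### Finite Green functions as real superharmonic functions. -/

/-- Finiteness everywhere is essential, since `toReal` sends ∞ to 0. -/
theorem laplacian_toReal (hμ : ∀ x, 0 < G.vertexWeight x) {f F : V → ℝ≥0∞}
    (hF : ∀ x, F x ≠ ∞) (h : ∀ x, F x = f x + G.avg F x) (x : V) :
    G.laplacian (fun y => (F y).toReal) x = -(f x).toReal := by
  have hf : f x ≠ ∞ := ne_top_of_le_ne_top (hF x) ((h x).symm ▸ le_self_add)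
  have ha : G.avg F x ≠ ∞ := ne_top_of_le_ne_top (hF x) ((h x).symm ▸ le_add_self)
  have e : (G.avg F x).toReal = ∑ y ∈ G.nbrs x, (G.transition x y : ℝ) * (F y).toReal := by
    rw [avg, ENNReal.toReal_sum fun y _ => ENNReal.mul_ne_top ENNReal.coe_ne_top (hF y)]
    exact Finset.sum_congr rfl fun y _ => by rw [ENNReal.toReal_mul, ENNReal.coe_toReal]
  rw [laplacian_eq (hμ x), ← e]
  have : (F x).toReal = (f x).toReal + (G.avg F x).toReal := by
    rw [← ENNReal.toReal_add hf ha, ← h]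
  linarith

open Classical in
theorem laplacian_green (hμ : ∀ x, 0 < G.vertexWeight x) {y : V}
    (hF : ∀ x, G.green x y ≠ ∞) (x : V) :
    G.laplacian (fun z => (G.green z y).toReal) x =
      -((Pi.single y (G.vertexWeight y : ℝ≥0∞)⁻¹ : V → ℝ≥0∞) x).toReal :=
  laplacian_toReal hμ hF (fun x => green_eq_add_avg hμ x y) x

theorem isSuperharmonic_green (hμ : ∀ x, 0 < G.vertexWeight x) {y : V}
    (hF : ∀ x, G.green x y ≠ ∞) : G.IsSuperharmonic fun z => (G.green z y).toReal := by
  classical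
  intro x
  rw [laplacian_green hμ hF, neg_neg]
  exact ENNReal.toReal_nonneg

theorem not_isHarmonic_green (hμ : ∀ x, 0 < G.vertexWeight x) {y : V}
    (hF : ∀ x, G.green x y ≠ ∞) : ¬ G.IsHarmonic fun z => (G.green z y).toReal := by
  classical
  intro h
  have := h y
  rw [laplacian_green hμ hF] at this
  simp [(hμ y).ne'] at this

/-! ### Each condition against `HasLqGreen`. -/

variable (G) in
/-- Some Green function `g(·,y)` lies in `L^q`. -/
def HasLqGreen (q : ℝ≥0∞) : Prop := ∃ y, G.lqNorm q (fun x => G.green x y) < ∞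

theorem hasLqGreen_of_le {q : ℝ≥0∞} (hq : 1 ≤ q) {y : V} {c : ℝ≥0∞} (hc : c ≠ 0)
    {F : V → ℝ≥0∞} (hF : G.lqNorm q F < ∞) (h : ∀ x, G.green x y * c ≤ F x) :
    G.HasLqGreen q := by
  refine ⟨y, ?_⟩
  have h1 := (lqNorm_mono (q := q) h).trans_lt hF
  rw [lqNorm_mul_const hq] at h1
  by_contra h2
  rw [not_lt, top_le_iff] at h2
  rw [h2, ENNReal.top_mul hc] at h1
  exact h1.ne rfl

theorem not_lqLiouville_iff [Infinite V] (hG : G.Connected) {q : ℝ≥0∞} (hq : 1 ≤ q) :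
    ¬ G.LqLiouville q ↔ G.HasLqGreen q := by
  have hμ := hG.vertexWeight_pos
  constructor
  · intro h
    simp only [LqLiouville, not_forall] at h
    obtain ⟨u, hs, ⟨hu, hq'⟩, hn⟩ := h
    obtain ⟨y, z, c, hc, hc', hle⟩ := hs.exists_green_le_min hG hu hn
    refine hasLqGreen_of_le hq hc hq' fun x => (hle x).trans ?_
    exact ENNReal.ofReal_le_ofReal ((min_le_left _ _).trans (le_abs_self _))
  · rintro ⟨y, hy⟩ h
    have hF := ne_top_of_lqNorm_lt_top hμ hq hy
    obtain ⟨c, hc⟩ := h _ (isSuperharmonic_green hμ hF) ⟨fun _ => ENNReal.toReal_nonneg, by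
      simpa only [abs_of_nonneg ENNReal.toReal_nonneg, ENNReal.ofReal_toReal (hF _)] using hy⟩
    refine not_isHarmonic_green hμ hF ?_
    rw [show (fun z => (G.green z y).toReal) = fun _ => c from funext hc]
    exact laplacian_const c

theorem greenOp_eq_potential (f : V → ℝ≥0) (x : V) :
    G.greenOp f x = G.potential (fun y => f y) x := rfl

theorem not_isLpParabolic_iff [Infinite V] (hG : G.Connected) {p : ℝ} (hp : 1 ≤ p) :
    ¬ G.IsLpParabolic p ↔ G.HasLqGreen (ENNReal.conjExponent (ENNReal.ofReal p)) := by
  classical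
  have hμ := hG.vertexWeight_pos
  have hq : 1 ≤ ENNReal.conjExponent (ENNReal.ofReal p) := le_self_add
  have hp0 : 0 < p := by linarith
  set q := ENNReal.conjExponent (ENNReal.ofReal p)
  constructor
  · intro h
    simp only [IsLpParabolic, capacity, not_forall, ENNReal.iSup_eq_zero] at h
    obtain ⟨K, f, ⟨-, hf⟩, hne⟩ := h
    rw [ENNReal.rpow_eq_zero_iff_of_pos hp0] at hne
    obtain ⟨y, -, hy⟩ := Finset.exists_ne_zero_of_sum_ne_zero hne
    exact hasLqGreen_of_le hq hy
      (hf.trans_lt ENNReal.one_lt_top) fun x => mul_le_potential (fun y => (f y : ℝ≥0∞)) x y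
  · rintro ⟨y, hy⟩ h
    set N := G.lqNorm q (fun x => G.green x y)
    -- The point mass ε at y has potential g(·,y)/(N+1), of norm at most 1; the summand 1 covers N =
    -- 0.
    set ε : ℝ≥0 := (N.toNNReal + 1)⁻¹ / G.vertexWeight y
    have hε : 0 < ε := div_pos (by positivity) (hμ y)
    have hmul : (ε : ℝ≥0∞) * G.vertexWeight y = ((N.toNNReal + 1)⁻¹ : ℝ≥0) := by
      rw [← ENNReal.coe_mul, div_mul_cancel₀ _ (hμ y).ne']
    have hcap := h {y}
    simp only [capacity, ENNReal.iSup_eq_zero] at hcap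
    have hz := hcap (Pi.single y ε) ⟨fun x hx => by simp_all, ?_⟩
    · rw [ENNReal.rpow_eq_zero_iff_of_pos hp0] at hz
      simp [hε.ne', (hμ y).ne'] at hz
    · have e : (fun z => ((Pi.single y ε : V → ℝ≥0) z : ℝ≥0∞)) = Pi.single y (ε : ℝ≥0∞) := by
        funext z
        by_cases hz : z = y
        · subst hz; simp
        · simp [hz]
      have e' : G.greenOp (Pi.single y ε) = fun x => G.green x y * ((N.toNNReal + 1)⁻¹ : ℝ≥0) := by
        funext x
        rw [greenOp_eq_potential, e, potential_single, hmul]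
      rw [e', lqNorm_mul_const hq]
      change N * _ ≤ 1
      rw [← ENNReal.coe_toNNReal hy.ne, ← ENNReal.coe_mul, ← ENNReal.coe_one, ENNReal.coe_le_coe,
        ENNReal.toNNReal_coe, ← div_eq_mul_inv]
      exact div_le_one_of_le₀ (by simp) zero_le

/-- Here q = ∞, and truncation supplies boundedness for free: the multiple of g(·,y) lies below the
constant u(z), so no integrability of u is needed. -/
theorem not_systemLiouville_one_iff [Infinite V] (hG : G.Connected) :
    ¬ G.SystemLiouville 1 ↔ G.HasLqGreen ∞ := by
  have hμ := hG.vertexWeight_pos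
  constructor
  · intro h
    simp only [SystemLiouville, not_forall] at h
    obtain ⟨u, hu, ⟨hs, -⟩, hn⟩ := h
    have hn' : ¬ ∃ c : ℝ, ∀ x, u x = c := by
      rintro ⟨c, hc⟩
      rw [show u = fun _ => c from funext hc] at hn
      exact hn (laplacian_const c)
    obtain ⟨y, z, c, hc, hc', hle⟩ := IsSuperharmonic.exists_green_le_min hG hu hs hn'
    refine hasLqGreen_of_le (F := fun _ => ENNReal.ofReal (u z)) le_top hc ?_
      fun x => (hle x).trans (ENNReal.ofReal_le_ofReal (min_le_right _ _))
    rw [lqNorm, if_pos rfl]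
    exact (iSup_le fun _ => le_rfl).trans_lt ENNReal.ofReal_lt_top
  · rintro ⟨y, hy⟩ h
    have hF := ne_top_of_lqNorm_lt_top hμ le_top hy
    refine not_isHarmonic_green hμ hF (h _ (fun _ => ENNReal.toReal_nonneg)
      ⟨isSuperharmonic_green hμ hF, fun x => ?_⟩)
    -- The exponent is 1 - 1 = 0 and t^0 = 1 even at t = 0, so the second inequality concerns the
    -- constant 1.
    simp [laplacian_const]

/-- No non-negative function has constant negative Laplacian. -/
theorem not_neg_laplacian_eq_const [Infinite V] (hG : G.Connected) {u : V → ℝ}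
    (hu : ∀ x, 0 ≤ u x) {c : ℝ} (hc : 0 < c) : ¬ ∀ x, -G.laplacian u x = c := by
  intro h
  have hμ := hG.vertexWeight_pos
  -- Since u = c + Pu, each averaging raises a uniform lower bound by c.
  have key : ∀ (N : ℕ) (x : V), N * c ≤ u x := by
    intro N
    induction N with
    | zero => simpa using hu
    | succ N ih =>
      intro x
      have hx := h x
      have h1 : ∑ y ∈ G.nbrs x, (G.transition x y : ℝ) = 1 := by
        exact_mod_cast G.sum_transition (hμ x)
      rw [laplacian_eq (hμ x)] at hx
      have h2 : ∑ y ∈ G.nbrs x, (G.transition x y : ℝ) * (N * c) ≤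
          ∑ y ∈ G.nbrs x, (G.transition x y : ℝ) * u y :=
        Finset.sum_le_sum fun y _ => by gcongr; exact ih y
      rw [← Finset.sum_mul, h1, one_mul] at h2
      push_cast
      linarith
  obtain ⟨x⟩ := hG.nonempty
  obtain ⟨N, hN⟩ := exists_nat_gt (u x / c)
  rw [div_lt_iff₀ hc] at hN
  exact (key N x).not_gt hN

theorem green_ne_top_of_lqGreen (hμ : ∀ x, 0 < G.vertexWeight x) {q : ℝ} (hq : 1 < q)
    (h : ∀ x y, G.lqGreen q x y ≠ ∞) (x y : V) : G.green x y ≠ ∞ := by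
  have h1 := h y y
  rw [lqGreen_self hμ hq] at h1
  have h2 := ENNReal.ne_top_of_tsum_ne_top h1 x
  intro h3
  rw [h3, ENNReal.top_rpow_of_pos (by linarith),
    ENNReal.top_mul (by simpa using (hμ x).ne')] at h2
  exact h2 rfl

theorem not_systemLiouville_iff [Infinite V] (hG : G.Connected) {p q : ℝ}
    (hpq : p.HolderConjugate q) :
    ¬ G.SystemLiouville p ↔ ∃ x y, G.lqGreen q x y ≠ ∞ := by
  have hμ := hG.vertexWeight_pos
  have hp1 : 0 < p - 1 := hpq.sub_one_pos
  have hq1 : 0 < q - 1 := hpq.symm.sub_one_pos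
  have hmul : (p - 1) * (q - 1) = 1 := by linarith [hpq.mul_eq_add, mul_comm p q]
  constructor
  · intro h
    simp only [SystemLiouville, not_forall] at h
    obtain ⟨u, hu, ⟨hs, hs'⟩, hn⟩ := h
    have hv : ∀ x, |G.laplacian u x| = -G.laplacian u x :=
      fun x => abs_of_nonpos (by linarith [hs x])
    have hw : ∀ x, (|G.laplacian u x| ^ (p - 1)) ^ (q - 1) = -G.laplacian u x := fun x => by
      rw [← Real.rpow_mul (abs_nonneg _), hmul, Real.rpow_one, hv]
    -- A constant w would make -Δu a constant, positive because u is not harmonic; no non-negative u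
    -- allows this.
    by_cases hcst : ∃ c : ℝ, ∀ x, |G.laplacian u x| ^ (p - 1) = c
    · obtain ⟨c, hc⟩ := hcst
      have hc' : ∀ x, -G.laplacian u x = c ^ (q - 1) := fun x => by rw [← hw, hc]
      obtain ⟨x, hx⟩ := not_forall.1 hn
      refine absurd hc' (not_neg_laplacian_eq_const hG hu ?_)
      rw [← hc' x]
      exact (hs x).lt_of_ne' (by simpa using hx)
    · obtain ⟨y, z, c, hc, hc', hle⟩ := IsSuperharmonic.exists_green_le_min hG
        (fun x => Real.rpow_nonneg (abs_nonneg _) _) hs' hcst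
      refine ⟨y, y, fun htop => ?_⟩
      have h1 : G.lqGreen q y y * c ^ (q - 1) ≤ ENNReal.ofReal (u y) := by
        refine le_trans ?_ (IsSuperharmonic.potential_le hμ hu hs y)
        rw [lqGreen, potential, ← ENNReal.tsum_mul_right]
        refine ENNReal.tsum_le_tsum fun x => ?_
        rw [mul_right_comm, mul_assoc (G.green y x), ← ENNReal.mul_rpow_of_nonneg _ _ hq1.le]
        gcongr
        refine (ENNReal.rpow_le_rpow (hle x) hq1.le).trans ?_
        rw [ENNReal.ofReal_rpow_of_nonneg (le_min (Real.rpow_nonneg (abs_nonneg _) _)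
          (Real.rpow_nonneg (abs_nonneg _) _)) hq1.le, ← hw x]
        refine ENNReal.ofReal_le_ofReal (Real.rpow_le_rpow ?_ (min_le_left _ _) hq1.le)
        exact le_min (Real.rpow_nonneg (abs_nonneg _) _) (Real.rpow_nonneg (abs_nonneg _) _)
      rw [htop, ENNReal.top_mul (by simp [ENNReal.rpow_eq_zero_iff, hc, hc']), top_le_iff] at h1
      exact ENNReal.ofReal_ne_top h1
  · rintro ⟨x, y, hxy⟩ h
    have hall := hG.lqGreen_ne_top hpq.symm.lt hxy
    have hg := green_ne_top_of_lqGreen hμ hpq.symm.lt hall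
    -- g_q(·,y) is the potential of g(·,y)^(q-1), so its negative Laplacian is that power, and
    -- raising to p - 1 returns g(·,y).
    have hlap := laplacian_toReal hμ (fun z => hall z y)
      (potential_eq_add_avg hμ fun z => G.green z y ^ (q - 1))
    have hlap' : ∀ x, |G.laplacian (fun z => (G.lqGreen q z y).toReal) x| ^ (p - 1) =
        (G.green x y).toReal := fun x => by
      rw [hlap, abs_neg, abs_of_nonneg ENNReal.toReal_nonneg, ← ENNReal.toReal_rpow,
        ← Real.rpow_mul ENNReal.toReal_nonneg, mul_comm, hmul, Real.rpow_one]
    have hharm := h (fun z => (G.lqGreen q z y).toReal) (fun _ => ENNReal.toReal_nonneg)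
      ⟨fun x => by rw [hlap, neg_neg]; exact ENNReal.toReal_nonneg, by
        rw [funext hlap']
        exact isSuperharmonic_green hμ fun x => hg x y⟩
    have h0 := hlap' y
    rw [hharm y, abs_zero, Real.zero_rpow hp1.ne'] at h0
    exact (ENNReal.toReal_pos (green_self_pos hμ y).ne' (hg y y)).ne h0

/-- For finite q and infinite total weight, the only constant in L^q is zero. -/
theorem lqLiouvilleZero_iff {q : ℝ≥0∞} (hq : 1 ≤ q)
    (hq' : q ≠ ∞) (hV : G.totalWeight = ∞) : G.LqLiouvilleZero q ↔ G.LqLiouville q := by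
  constructor
  · exact fun h u hs hu => ⟨0, h u hs hu⟩
  · intro h u hs hu x
    obtain ⟨c, hc⟩ := h u hs hu
    have h0 : 0 < q.toReal := ENNReal.toReal_pos (zero_lt_one.trans_le hq).ne' hq'
    have h1 := (lqNorm_lt_top_iff hq' h0 _).1 hu.2
    simp only [hc] at h1 ⊢
    rw [ENNReal.tsum_mul_left, ← totalWeight, hV] at h1
    by_contra hne
    refine h1.ne (ENNReal.mul_top ?_)
    rw [Ne, ENNReal.rpow_eq_zero_iff_of_pos h0]
    simpa using hne

end WeightedGraph

/-! ### Assembly of the equivalences. -/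

theorem theorem1p1 {V : Type*} [Infinite V] (G : WeightedGraph V) (hG : G.Connected)
    (p : ℝ) (hp : 1 ≤ p) (q : ℝ≥0∞) (hpq : (ENNReal.ofReal p).HolderConjugate q) :
    [G.IsLpParabolic p, G.LqLiouville q, G.SystemLiouville p].TFAE ∧
    (1 < p →
      [G.IsLpParabolic p, G.LqLiouville q, G.SystemLiouville p,
        ∃ x y, G.lqGreen q.toReal x y = ∞, ∀ x y, G.lqGreen q.toReal x y = ∞].TFAE) ∧
    (1 < p → G.totalWeight = ∞ →
      [G.IsLpParabolic p, G.LqLiouvilleZero q, G.SystemLiouville p,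
        ∃ x y, G.lqGreen q.toReal x y = ∞, ∀ x y, G.lqGreen q.toReal x y = ∞].TFAE) := by
  have hμ := hG.vertexWeight_pos
  have hconj : ENNReal.conjExponent (ENNReal.ofReal p) = q :=
    ENNReal.HolderConjugate.conjExponent_eq
  have hq : 1 ≤ q := hconj ▸ le_self_add
  have hI : G.IsLpParabolic p ↔ ¬ G.HasLqGreen q := by
    rw [← hconj, ← WeightedGraph.not_isLpParabolic_iff hG hp, not_not]
  have hII : G.LqLiouville q ↔ ¬ G.HasLqGreen q := by
    rw [← WeightedGraph.not_lqLiouville_iff hG hq, not_not]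
  have hlt : 1 < p → (q ≠ ∞ ∧ p.HolderConjugate q.toReal) := fun hp1 => by
    have hq' : q ≠ ∞ := by
      rw [← hconj, ENNReal.conjExponent]
      simpa [tsub_eq_zero_iff_le] using hp1
    have := ENNReal.HolderConjugate.toReal_of_ne_top (p := ENNReal.ofReal p) (q := q) ENNReal.ofReal_ne_top hq'
    rw [ENNReal.toReal_ofReal (by linarith)] at this
    exact ⟨hq', this⟩
  have hall : 1 < p → ((∀ x y, G.lqGreen q.toReal x y = ∞) ↔
      ∃ x y, G.lqGreen q.toReal x y = ∞) := fun hp1 => by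
    refine ⟨fun h => ?_, ?_⟩
    · obtain ⟨x⟩ := hG.nonempty
      exact ⟨x, x, h x x⟩
    · rintro ⟨x, y, hxy⟩ x' y'
      by_contra hne
      exact hG.lqGreen_ne_top (hlt hp1).2.symm.lt hne x y hxy
  have hgreen : 1 < p → ((∀ x y, G.lqGreen q.toReal x y = ∞) ↔ ¬ G.HasLqGreen q) := fun hp1 => by
    obtain ⟨hq', hr⟩ := hlt hp1
    constructor
    · rintro h ⟨y, hy⟩
      rw [WeightedGraph.lqNorm_green_lt_top_iff hμ hq' hr.symm.lt, h y y] at hy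
      exact hy.ne rfl
    · intro h x y
      by_contra hne
      refine h ⟨y, ?_⟩
      rw [WeightedGraph.lqNorm_green_lt_top_iff hμ hq' hr.symm.lt]
      exact (hG.lqGreen_ne_top hr.symm.lt hne y y).lt_top
  have hIII : G.SystemLiouville p ↔ ¬ G.HasLqGreen q := by
    rcases hp.eq_or_lt with rfl | hp1
    · have : q = ∞ := by rw [← hconj]; simp [ENNReal.conjExponent]
      rw [this, ← WeightedGraph.not_systemLiouville_one_iff hG, not_not]
    · rw [← hgreen hp1, ← not_iff_not, WeightedGraph.not_systemLiouville_iff hG (hlt hp1).2]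
      push Not
      rfl
  refine ⟨?_, fun hp1 => ?_, fun hp1 hV => ?_⟩
  · tfae_have 1 ↔ 2 := hI.trans hII.symm
    tfae_have 3 ↔ 2 := hIII.trans hII.symm
    tfae_finish
  · tfae_have 1 ↔ 2 := hI.trans hII.symm
    tfae_have 3 ↔ 2 := hIII.trans hII.symm
    tfae_have 5 ↔ 2 := (hgreen hp1).trans hII.symm
    tfae_have 5 ↔ 4 := hall hp1
    tfae_finish
  · have hII' := (WeightedGraph.lqLiouvilleZero_iff hq (hlt hp1).1 hV).trans hII
    tfae_have 1 ↔ 2 := hI.trans hII'.symm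
    tfae_have 3 ↔ 2 := hIII.trans hII'.symm
    tfae_have 5 ↔ 2 := (hgreen hp1).trans hII'.symm
    tfae_have 5 ↔ 4 := hall hp1
    tfae_finish
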